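/- A tetrahedron $T$ is the convex hull of four points in $\mathbb{R}^3$ not lying in one plane, and $\Sigma_T$ denotes the sum of its six interior dihedral angles, one for each edge. A 4-ball tetrahedron is a tetrahedron for which there exists a sphere tangent to all six edges (tangent at points of the edges themselves, regarded as segments). 1. Every 4-ball tetrahedron $T$ satisfies $$6\arccos\tfrac13\le\Sigma_T<3\pi .$$ 2. For every real $v$ with $6\arccos\tfrac13\le v<3\pi$ there is a 4-ball tetrahedron $T$ with $\Sigma_T=v$. 3. Every regular tetrahedron is a 4-ball tetrahedron and satisfies $\Sigma_T=6\arccos\tfrac13$. 4. For $h>0$ let $P_h$ be the regular triangular pyramid of height $h$ over an equilateral triangle inscribed in a unit circle, i.e. the tetrahedron with vertices $(1,0,0)$, $(-\tfrac12,\pm\tfrac{\sqrt3}{2},0)$ and $(0,0,h)$. Then every $P_h$ is a 4-ball tetrahedron, and for every real $v$ with $6\arccos\tfrac13\le v<3\pi$ there is $h>0$ with $\Sigma_{P_h}=v$. -/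

import Mathlib

open scoped RealInnerProductSpace Affine

/-- Euclidean three-space. -/
abbrev E3 : Type := EuclideanSpace ℝ (Fin 3)

/-- A (labelled) tetrahedron: four points of Euclidean space that do not lie in one plane. -/
abbrev Tetrahedron : Type := Affine.Simplex ℝ E3 3

namespace Tetrahedron

/-- The component of the vector `v` orthogonal to the vector `u` (meant for `u ≠ 0`). -/
noncomputable def orthPart (u v : E3) : E3 := v - (⟪u, v⟫ / ⟪u, u⟫) • u

/-- The interior dihedral angle at the edge joining the vertices `i` and `j`, where `k` and `l` are
the two other vertices: the angle between the two vectors that are orthogonal to the edge and point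
from it into the faces `i j k` and `i j l`. -/
noncomputable def dihedralAngle (T : Tetrahedron) (i j k l : Fin 4) : ℝ :=
  InnerProductGeometry.angle
    (orthPart (T.points j - T.points i) (T.points k - T.points i))
    (orthPart (T.points j - T.points i) (T.points l - T.points i))

/-- The dihedral angle sum: the sum of the dihedral angles at all six edges. -/
noncomputable def dihedralAngleSum (T : Tetrahedron) : ℝ :=
  T.dihedralAngle 0 1 2 3 + T.dihedralAngle 0 2 1 3 + T.dihedralAngle 0 3 1 2 +
    T.dihedralAngle 1 2 0 3 + T.dihedralAngle 1 3 0 2 + T.dihedralAngle 2 3 0 1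

/-- The sphere `S` touches the segment `[a, b]`: it is tangent to the line through `a` and `b` at a
point of the segment. -/
def TouchesSegment (S : EuclideanGeometry.Sphere E3) (a b : E3) : Prop :=
  ∃ p ∈ segment ℝ a b, S.IsTangentAt p line[ℝ, a, b]

/-- A 4-ball tetrahedron: there is a sphere (a mid-sphere) tangent to all six edges. The edges are
segments, so tangency to the extension of an edge beyond its endpoints does not count. -/
def IsFourBall (T : Tetrahedron) : Prop :=
  ∃ S : EuclideanGeometry.Sphere E3, 0 < S.radius ∧
    ∀ i j : Fin 4, i ≠ j → TouchesSegment S (T.points i) (T.points j)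

/-- Vertices of the regular triangular pyramid of height `h`: an equilateral base, inscribed in the
unit circle of the plane `z = 0`, and the apex at height `h` above the centre of the base. -/
noncomputable def pyramidPoints (h : ℝ) : Fin 4 → E3 :=
  ![!₂[1, 0, 0], !₂[-1 / 2, √3 / 2, 0], !₂[-1 / 2, -(√3 / 2), 0], !₂[0, 0, h]]

theorem affineIndependent_pyramidPoints {h : ℝ} (hh : 0 < h) :
    AffineIndependent ℝ (pyramidPoints h) := by
  rw [affineIndependent_iff_of_fintype]
  intro w hw hsum
  rw [Finset.weightedVSub_eq_linear_combination (s := Finset.univ) hw] at hsum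
  have h0 := congrArg (fun v : E3 => v 0) hsum
  have h1 := congrArg (fun v : E3 => v 1) hsum
  have h2 := congrArg (fun v : E3 => v 2) hsum
  simp [Fin.sum_univ_four, pyramidPoints] at h0 h1 h2 hw
  have h3 : 0 < √(3 : ℝ) := by positivity
  have e3 : w 3 = 0 := by
    rcases h2 with h2 | h2
    · exact h2
    · exact absurd h2 hh.ne'
  have e12 : w 1 = w 2 := by
    have : √3 / 2 * (w 1 - w 2) = 0 := by linarith
    rcases mul_eq_zero.mp this with h | h <;> linarith
  intro i
  fin_cases i <;> simp <;> linarith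

/-- The regular triangular pyramid of height `h > 0` over a fixed equilateral base. -/
noncomputable def regularPyramid (h : ℝ) (hh : 0 < h) : Tetrahedron :=
  ⟨pyramidPoints h, affineIndependent_pyramidPoints hh⟩

end Tetrahedron

/-!
A tetrahedron has a mid-sphere only if its edge lengths are `r i + r j` with positive tangent
lengths `r i` (`IsFourBall.exists_hasTangentLengths`). Put `b i = ρ / r i`, where `ρ` is the radius
of the mid-sphere, and `S = ∑ b i`. The `b i` are the cotangents of the angular radii of the four
mutually tangent circles in which the tangent cones from the vertices touch the sphere, and they
satisfy the spherical Descartes equation `S ^ 2 - 2 * ∑ b i ^ 2 = 4`. The incircles of the faces are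
four further mutually tangent circles on the sphere; the one opposite the vertex `k` has an angular
radius `ψ k` with `cot (ψ k) = S / 2 - b k`. Since the edge `i j` is tangent to the sphere where the
incircles of its two faces meet, the tangent-chord angle gives the dihedral angle `π - ψ k - ψ l`,
that is, `arctan (S / 2 - b k) + arctan (S / 2 - b l)`. In the formal proof this is an algebraic
identity in the edge lengths (`HasTangentLengths.dihedralAngle_eq`), and the Descartes equation is a
choice of `ρ`, which is possible because the volume is positive (`HasTangentLengths.descartes_pos`).

Each vertex `k` is opposite to one face, with three edges, so the angle sum is `3 * Θ` with
`Θ = ∑ k, arctan (S / 2 - b k)`. Expanding `∏ k, (1 + (S / 2 - b k) * I)` with the Descartes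
equation leaves imaginary part `σ₃` and real part `-(σ₃ * S / 2 - σ₄)`, with `σ₃`, `σ₄` the
elementary symmetric functions of `b`. As `0 < Θ < 2π`, the sign of `σ₃` forces `Θ < π`. Moreover
`16 σ₄ ≤ S σ₃`, and `8 ≤ S ^ 2` by the Descartes equation, so that `49 sin² Θ ≤ 32 cos² Θ` and
`cos Θ ≤ -7 / 9`, which is `cos (2 * arccos (1 / 3))` (`sum_arctan_bounds`).

For the regular pyramids the angle sum is continuous in the height. It equals `6 * arccos (1 / 3)` at
height `√2`, where the pyramid is a regular tetrahedron, and approaches `3 * π` at height `0`, where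
`ρ` tends to infinity. The intermediate value theorem gives every value between.
-/

namespace Tetrahedron

/-! ### Sums of arctangents -/

theorem cos_arctan_add (c d : ℝ) :
    Real.cos (Real.arctan c + Real.arctan d) =
      (1 - c * d) * (Real.cos (Real.arctan c) * Real.cos (Real.arctan d)) := by
  rw [Real.cos_add, ← Real.tan_mul_cos (Real.cos_arctan_pos c).ne',
    ← Real.tan_mul_cos (Real.cos_arctan_pos d).ne', Real.tan_arctan, Real.tan_arctan]
  ring

theorem sin_arctan_add (c d : ℝ) :
    Real.sin (Real.arctan c + Real.arctan d) =
      (c + d) * (Real.cos (Real.arctan c) * Real.cos (Real.arctan d)) := by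
  rw [Real.sin_add, ← Real.tan_mul_cos (Real.cos_arctan_pos c).ne',
    ← Real.tan_mul_cos (Real.cos_arctan_pos d).ne', Real.tan_arctan, Real.tan_arctan]
  ring

theorem arctan_add_pos {c d : ℝ} (h : 0 < c + d) : 0 < Real.arctan c + Real.arctan d := by
  have := Real.arctan_strictMono (show -d < c by linarith)
  rw [Real.arctan_neg] at this
  linarith

theorem arctan_add_lt_pi (c d : ℝ) : Real.arctan c + Real.arctan d < Real.pi := by
  linarith [Real.arctan_lt_pi_div_two c, Real.arctan_lt_pi_div_two d]

/-- Two vectors with norms `m * √(1 + d ^ 2)` and `n * √(1 + c ^ 2)` whose inner product is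
`m * n * (1 - c * d)` enclose the angle `arctan c + arctan d`, provided that this is positive. -/
theorem angle_eq_arctan_add_arctan {U V : E3} {m n c d : ℝ} (hm : 0 < m) (hn : 0 < n)
    (hcd : 0 < c + d) (hU : ⟪U, U⟫ = m ^ 2 * (1 + d ^ 2)) (hV : ⟪V, V⟫ = n ^ 2 * (1 + c ^ 2))
    (hUV : ⟪U, V⟫ = m * n * (1 - c * d)) :
    InnerProductGeometry.angle U V = Real.arctan c + Real.arctan d := by
  have hU' : ‖U‖ = m * √(1 + d ^ 2) := by
    rw [norm_eq_sqrt_real_inner, hU, Real.sqrt_mul (by positivity), Real.sqrt_sq hm.le]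
  have hV' : ‖V‖ = n * √(1 + c ^ 2) := by
    rw [norm_eq_sqrt_real_inner, hV, Real.sqrt_mul (by positivity), Real.sqrt_sq hn.le]
  have hc : 0 < √(1 + c ^ 2) := by positivity
  have hd : 0 < √(1 + d ^ 2) := by positivity
  rw [InnerProductGeometry.angle, ← Real.arccos_cos (arctan_add_pos hcd).le
    (arctan_add_lt_pi c d).le, cos_arctan_add, hUV, hU', hV', Real.cos_arctan, Real.cos_arctan]
  congr 1
  field_simp

/-! ### Orthogonal parts and linear independence -/

/-- The strict Cauchy–Schwarz inequality for linearly independent vectors. -/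
theorem inner_sq_lt {a b : E3} (h : LinearIndependent ℝ ![a, b]) :
    ⟪a, b⟫ ^ 2 < ⟪a, a⟫ * ⟪b, b⟫ := by
  have hb : b ≠ 0 := h.ne_zero 1
  have hbb : 0 < ⟪b, b⟫ := real_inner_self_pos.2 hb
  have hne : a - (⟪a, b⟫ / ⟪b, b⟫) • b ≠ 0 := by
    intro h0
    rw [LinearIndependent.pair_iff] at h
    have := (h 1 (-(⟪a, b⟫ / ⟪b, b⟫)) (by rw [one_smul, neg_smul, ← sub_eq_add_neg, h0])).1
    exact one_ne_zero this
  have := real_inner_self_pos.2 hne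
  rw [inner_sub_left, inner_sub_right, inner_sub_right, real_inner_smul_left,
    real_inner_smul_right, real_inner_smul_left, real_inner_smul_right, real_inner_comm a b] at this
  have h2 : ⟪a, a⟫ * ⟪b, b⟫ - ⟪a, b⟫ ^ 2 = ⟪b, b⟫ * (⟪a, a⟫ - ⟪a, b⟫ / ⟪b, b⟫ * ⟪a, b⟫ -
      (⟪a, b⟫ / ⟪b, b⟫ * ⟪a, b⟫ - ⟪a, b⟫ / ⟪b, b⟫ * (⟪a, b⟫ / ⟪b, b⟫ * ⟪b, b⟫))) := by
    field_simp
    ring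
  have h3 := mul_pos hbb this
  linarith

theorem inner_orthPart {a : E3} (ha : a ≠ 0) (b c : E3) :
    ⟪orthPart a b, orthPart a c⟫ = ⟪b, c⟫ - ⟪a, b⟫ * ⟪a, c⟫ / ⟪a, a⟫ := by
  have haa : ⟪a, a⟫ ≠ 0 := (real_inner_self_pos.2 ha).ne'
  rw [orthPart, orthPart, inner_sub_left, inner_sub_right, inner_sub_right, real_inner_smul_left,
    real_inner_smul_right, real_inner_smul_left, real_inner_smul_right, real_inner_comm a b]
  field_simp
  ring

theorem linearIndependent_orthPart {a b c : E3} (h : LinearIndependent ℝ ![a, b, c]) :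
    LinearIndependent ℝ ![orthPart a b, orthPart a c] := by
  rw [LinearIndependent.pair_iff]
  intro s t hst
  rw [Fintype.linearIndependent_iff] at h
  have := h ![-(s * (⟪a, b⟫ / ⟪a, a⟫) + t * (⟪a, c⟫ / ⟪a, a⟫)), s, t] (by
    rw [Fin.sum_univ_three, ← hst]
    simp only [orthPart, Matrix.cons_val]
    module)
  exact ⟨this 1, this 2⟩

theorem linearIndependent_edges (T : Tetrahedron) {i j k l : Fin 4} (hij : i ≠ j) (hik : i ≠ k)
    (hil : i ≠ l) (hjk : j ≠ k) (hjl : j ≠ l) (hkl : k ≠ l) :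
    LinearIndependent ℝ ![T.points j - T.points i, T.points k - T.points i,
      T.points l - T.points i] := by
  have h := (affineIndependent_iff_linearIndependent_vsub ℝ T.points i).1 T.independent
  have hinj : Function.Injective
      (![⟨j, hij.symm⟩, ⟨k, hik.symm⟩, ⟨l, hil.symm⟩] : Fin 3 → {x : Fin 4 // x ≠ i}) := by
    intro x y hxy
    fin_cases x <;> fin_cases y <;> simp_all [eq_comm]
  have e : ![T.points j - T.points i, T.points k - T.points i, T.points l - T.points i] =
      (fun x : {x : Fin 4 // x ≠ i} => (T.points x -ᵥ T.points i : E3)) ∘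
        ![⟨j, hij.symm⟩, ⟨k, hik.symm⟩, ⟨l, hil.symm⟩] := by
    funext x
    fin_cases x <;> rfl
  rw [e]
  exact h.comp _ hinj

/-! ### Tangent lengths and dihedral angles -/

theorem exists_other_vertices (i : Fin 4) :
    ∃ j k l : Fin 4, i ≠ j ∧ i ≠ k ∧ i ≠ l ∧ j ≠ k ∧ j ≠ l ∧ k ≠ l := by
  revert i
  decide

theorem sum_eq_of_distinct {M : Type*} [AddCommMonoid M] (f : Fin 4 → M) {i j k l : Fin 4}
    (hij : i ≠ j) (hik : i ≠ k) (hil : i ≠ l) (hjk : j ≠ k) (hjl : j ≠ l) (hkl : k ≠ l) :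
    ∑ x, f x = f i + f j + f k + f l := by
  have huniv : (Finset.univ : Finset (Fin 4)) = {i, j, k, l} := by
    symm
    rw [← Finset.card_eq_iff_eq_univ]
    simp [*]
  rw [huniv, Finset.sum_insert (by simp [*]), Finset.sum_insert (by simp [*]),
    Finset.sum_insert (by simp [*]), Finset.sum_singleton]
  simp only [add_assoc]

/-- The edge lengths of `T` are the sums `r i + r j`. If `T` has a mid-sphere, this holds with `r i`
the length of the tangents from the vertex `i` to it. Positivity of `r` is not part of the
definition. -/
def HasTangentLengths (T : Tetrahedron) (r : Fin 4 → ℝ) : Prop :=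
  ∀ i j, i ≠ j → dist (T.points i) (T.points j) = r i + r j

theorem HasTangentLengths.inner_self {T : Tetrahedron} {r : Fin 4 → ℝ} (hr : T.HasTangentLengths r)
    {i j : Fin 4} (hij : i ≠ j) :
    ⟪T.points j - T.points i, T.points j - T.points i⟫ = (r i + r j) ^ 2 := by
  rw [real_inner_self_eq_norm_sq, ← dist_eq_norm, dist_comm, hr i j hij]

theorem HasTangentLengths.inner_edges {T : Tetrahedron} {r : Fin 4 → ℝ} (hr : T.HasTangentLengths r)
    {i j k : Fin 4} (hij : i ≠ j) (hik : i ≠ k) (hjk : j ≠ k) :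
    ⟪T.points j - T.points i, T.points k - T.points i⟫ =
      r i * (r i + r j + r k) - r j * r k := by
  have h := norm_sub_sq_real (T.points j - T.points i) (T.points k - T.points i)
  rw [sub_sub_sub_cancel_right, ← dist_eq_norm, ← dist_eq_norm, ← dist_eq_norm,
    dist_comm (T.points j) (T.points i), dist_comm (T.points k) (T.points i), hr _ _ hij,
    hr _ _ hik, hr _ _ hjk] at h
  linarith

/-- By Heron's formula the product is the square of the area of the face `i j k`. In particular no
tangent length vanishes. -/
theorem HasTangentLengths.face_pos {T : Tetrahedron} {r : Fin 4 → ℝ} (hr : T.HasTangentLengths r)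
    {i j k l : Fin 4} (hij : i ≠ j) (hik : i ≠ k)
    (hil : i ≠ l) (hjk : j ≠ k) (hjl : j ≠ l) (hkl : k ≠ l) :
    0 < r i * r j * r k * (r i + r j + r k) := by
  have h := T.linearIndependent_edges hij hik hil hjk hjl hkl
  have h2 : LinearIndependent ℝ ![T.points j - T.points i, T.points k - T.points i] := by
    convert h.comp ![0, 1] (by decide) using 1
    ext x
    fin_cases x <;> rfl
  have h3 := inner_sq_lt h2
  rw [hr.inner_edges hij hik hjk, hr.inner_self hij, hr.inner_self hik] at h3
  linarith

theorem HasTangentLengths.inner_orthPart {T : Tetrahedron} {r : Fin 4 → ℝ}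
    (hr : T.HasTangentLengths r) {i j k l : Fin 4} (hij : i ≠ j) (hik : i ≠ k)
    (hil : i ≠ l) (hjk : j ≠ k) (hjl : j ≠ l) (hkl : k ≠ l) :
    ⟪orthPart (T.points j - T.points i) (T.points k - T.points i),
      orthPart (T.points j - T.points i) (T.points l - T.points i)⟫ =
    r i * (r i + r k + r l) - r k * r l - (r i * (r i + r j + r k) - r j * r k) *
      (r i * (r i + r j + r l) - r j * r l) / (r i + r j) ^ 2 := by
  rw [Tetrahedron.inner_orthPart (sub_ne_zero.2 fun h => hij (T.independent.injective h.symm)),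
    hr.inner_edges hij hik hjk, hr.inner_edges hij hil hjl, hr.inner_edges hik hil hkl,
    hr.inner_self hij]

theorem HasTangentLengths.inner_self_orthPart {T : Tetrahedron} {r : Fin 4 → ℝ}
    (hr : T.HasTangentLengths r) {i j k : Fin 4} (hij : i ≠ j) (hik : i ≠ k) (hjk : j ≠ k) :
    ⟪orthPart (T.points j - T.points i) (T.points k - T.points i),
      orthPart (T.points j - T.points i) (T.points k - T.points i)⟫ =
    (r i + r k) ^ 2 - (r i * (r i + r j + r k) - r j * r k) ^ 2 / (r i + r j) ^ 2 := by
  rw [Tetrahedron.inner_orthPart (sub_ne_zero.2 fun h => hij (T.independent.injective h.symm)),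
    hr.inner_edges hij hik hjk, hr.inner_self hij, hr.inner_self hik, sq (r i * _ - _)]

/-- The Descartes form of the reciprocal tangent lengths is a positive multiple of the squared volume:
it comes from the Gram determinant of the parts, orthogonal to an edge, of two other edges. -/
theorem HasTangentLengths.descartes_pos {T : Tetrahedron} {r : Fin 4 → ℝ}
    (hr : T.HasTangentLengths r) (hpos : ∀ i, 0 < r i) :
    0 < (∑ i, (r i)⁻¹) ^ 2 - 2 * ∑ i, (r i)⁻¹ ^ 2 := by
  have h := inner_sq_lt (linearIndependent_orthPart (T.linearIndependent_edges
    (i := 0) (j := 1) (k := 2) (l := 3) (by decide) (by decide) (by decide) (by decide) (by decide)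
    (by decide)))
  rw [hr.inner_orthPart (by decide) (by decide) (by decide) (by decide) (by decide) (by decide),
    hr.inner_self_orthPart (by decide) (by decide) (by decide),
    hr.inner_self_orthPart (by decide) (by decide) (by decide)] at h
  simp only [Fin.sum_univ_four]
  have h0 := hpos 0
  have h1 := hpos 1
  have h2 := hpos 2
  have h3 := hpos 3
  generalize r 0 = p at *
  generalize r 1 = q at *
  generalize r 2 = s at *
  generalize r 3 = t at *
  have key : ((p + s) ^ 2 - (p * (p + q + s) - q * s) ^ 2 / (p + q) ^ 2) *
      ((p + t) ^ 2 - (p * (p + q + t) - q * t) ^ 2 / (p + q) ^ 2) -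
      (p * (p + s + t) - s * t - (p * (p + q + s) - q * s) * (p * (p + q + t) - q * t) /
        (p + q) ^ 2) ^ 2 = 4 * (p * q * s * t) ^ 2 / (p + q) ^ 2 *
      ((p⁻¹ + q⁻¹ + s⁻¹ + t⁻¹) ^ 2 - 2 * (p⁻¹ ^ 2 + q⁻¹ ^ 2 + s⁻¹ ^ 2 + t⁻¹ ^ 2)) := by
    field_simp
    ring
  have hc : 0 < 4 * (p * q * s * t) ^ 2 / (p + q) ^ 2 := by positivity
  refine pos_of_mul_pos_right ?_ hc.le
  rw [← key]
  linarith

/-- The dihedral angle at an edge `i j`, where the `b i` are the tangent lengths' reciprocals, scaled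
to satisfy the spherical Descartes equation. The two summands are `π / 2` minus the angular radii,
seen from the centre of the mid-sphere, of the incircles of the faces opposite `k` and `l`. -/
theorem HasTangentLengths.dihedralAngle_eq {T : Tetrahedron} {b : Fin 4 → ℝ} {ρ : ℝ} (hρ : 0 < ρ)
    (hb : ∀ i, 0 < b i) (hr : T.HasTangentLengths fun i => ρ / b i)
    (hK : (∑ i, b i) ^ 2 - 2 * ∑ i, b i ^ 2 = 4) {i j k l : Fin 4} (hij : i ≠ j) (hik : i ≠ k)
    (hil : i ≠ l) (hjk : j ≠ k) (hjl : j ≠ l) (hkl : k ≠ l) :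
    T.dihedralAngle i j k l =
      Real.arctan ((∑ i, b i) / 2 - b k) + Real.arctan ((∑ i, b i) / 2 - b l) := by
  have hsum (f : Fin 4 → ℝ) := sum_eq_of_distinct f hij hik hil hjk hjl hkl
  rw [hsum, hsum] at hK
  rw [hsum]
  have hi := hb i
  have hj := hb j
  have hk := hb k
  have hl := hb l
  unfold dihedralAngle
  apply angle_eq_arctan_add_arctan (m := 2 * ρ / (b k * (b i + b j)))
    (n := 2 * ρ / (b l * (b i + b j))) (by positivity) (by positivity) (by linarith)
  · rw [hr.inner_self_orthPart hij hik hjk]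
    have : 1 + ((b i + b j + b k + b l) / 2 - b l) ^ 2 = b i * b j + b i * b k + b j * b k := by
      linear_combination hK / (-4)
    rw [this]
    field_simp
    ring
  · rw [hr.inner_self_orthPart hij hil hjl]
    have : 1 + ((b i + b j + b k + b l) / 2 - b k) ^ 2 = b i * b j + b i * b l + b j * b l := by
      linear_combination hK / (-4)
    rw [this]
    field_simp
    ring
  · rw [hr.inner_orthPart hij hik hil hjk hjl hkl]
    have : 1 - ((b i + b j + b k + b l) / 2 - b k) * ((b i + b j + b k + b l) / 2 - b l) =
        ((b i + b j) * (b k + b l) - b i ^ 2 - b j ^ 2) / 2 := by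
      linear_combination hK / (-4)
    rw [this]
    field_simp
    ring

theorem HasTangentLengths.dihedralAngleSum_eq {T : Tetrahedron} {b : Fin 4 → ℝ} {ρ : ℝ}
    (hρ : 0 < ρ) (hb : ∀ i, 0 < b i) (hr : T.HasTangentLengths fun i => ρ / b i)
    (hK : (∑ i, b i) ^ 2 - 2 * ∑ i, b i ^ 2 = 4) :
    T.dihedralAngleSum = 3 * ∑ k, Real.arctan ((∑ i, b i) / 2 - b k) := by
  unfold dihedralAngleSum
  rw [hr.dihedralAngle_eq hρ hb hK (i := 0) (j := 1) (k := 2) (l := 3) (by decide) (by decide)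
      (by decide) (by decide) (by decide) (by decide),
    hr.dihedralAngle_eq hρ hb hK (i := 0) (j := 2) (k := 1) (l := 3) (by decide) (by decide)
      (by decide) (by decide) (by decide) (by decide),
    hr.dihedralAngle_eq hρ hb hK (i := 0) (j := 3) (k := 1) (l := 2) (by decide) (by decide)
      (by decide) (by decide) (by decide) (by decide),
    hr.dihedralAngle_eq hρ hb hK (i := 1) (j := 2) (k := 0) (l := 3) (by decide) (by decide)
      (by decide) (by decide) (by decide) (by decide),
    hr.dihedralAngle_eq hρ hb hK (i := 1) (j := 3) (k := 0) (l := 2) (by decide) (by decide)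
      (by decide) (by decide) (by decide) (by decide),
    hr.dihedralAngle_eq hρ hb hK (i := 2) (j := 3) (k := 0) (l := 1) (by decide) (by decide)
      (by decide) (by decide) (by decide) (by decide),
    Fin.sum_univ_four (f := fun k => Real.arctan ((∑ i, b i) / 2 - b k))]
  ring

/-! ### Normalized curvatures and the angle sum -/

/-- The reciprocal tangent lengths, scaled to satisfy the spherical Descartes equation. The factor is
the radius of the mid-sphere, so `curvature r i` is the geodesic curvature on the unit sphere, the
cotangent of the angular radius, of the circle in which the tangent cone from the vertex `i` touches
the mid-sphere. -/
noncomputable def curvature (r : Fin 4 → ℝ) (i : Fin 4) : ℝ :=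
  2 / √((∑ i, (r i)⁻¹) ^ 2 - 2 * ∑ i, (r i)⁻¹ ^ 2) * (r i)⁻¹

theorem HasTangentLengths.curvature_pos {T : Tetrahedron} {r : Fin 4 → ℝ}
    (hr : T.HasTangentLengths r) (hpos : ∀ i, 0 < r i) (i : Fin 4) : 0 < curvature r i := by
  have := Real.sqrt_pos.2 (hr.descartes_pos hpos)
  have := hpos i
  unfold curvature
  positivity

theorem HasTangentLengths.descartes {T : Tetrahedron} {r : Fin 4 → ℝ}
    (hr : T.HasTangentLengths r) (hpos : ∀ i, 0 < r i) :
    (∑ i, curvature r i) ^ 2 - 2 * ∑ i, curvature r i ^ 2 = 4 := by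
  have h := hr.descartes_pos hpos
  unfold curvature
  simp_rw [mul_pow, ← Finset.mul_sum]
  rw [mul_pow, mul_left_comm 2, ← mul_sub, div_pow, Real.sq_sqrt h.le]
  rw [div_mul_cancel₀ _ h.ne']
  norm_num

theorem HasTangentLengths.dihedralAngleSum_eq_curvature {T : Tetrahedron} {r : Fin 4 → ℝ}
    (hr : T.HasTangentLengths r) (hpos : ∀ i, 0 < r i) :
    T.dihedralAngleSum =
      3 * ∑ k, Real.arctan ((∑ i, curvature r i) / 2 - curvature r k) := by
  have h := Real.sqrt_pos.2 (hr.descartes_pos hpos)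
  refine HasTangentLengths.dihedralAngleSum_eq (div_pos two_pos h) (hr.curvature_pos hpos) ?_
    (hr.descartes hpos)
  convert hr using 2 with i
  have := hpos i
  rw [curvature, div_mul_eq_div_div, div_self (div_pos two_pos h).ne', one_div, inv_inv]

/-! ### Bounds for the angle sum -/

/-- The bounds on the angle sum of a 4-ball tetrahedron, divided by three. -/
theorem sum_arctan_bounds {b : Fin 4 → ℝ} (hb : ∀ i, 0 < b i)
    (hK : (∑ i, b i) ^ 2 - 2 * ∑ i, b i ^ 2 = 4) :
    2 * Real.arccos (1 / 3) ≤ ∑ k, Real.arctan ((∑ i, b i) / 2 - b k) ∧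
      ∑ k, Real.arctan ((∑ i, b i) / 2 - b k) < Real.pi := by
  simp only [Fin.sum_univ_four] at hK ⊢
  have h0 := hb 0
  have h1 := hb 1
  have h2 := hb 2
  have h3 := hb 3
  generalize b 0 = p at *
  generalize b 1 = q at *
  generalize b 2 = s at *
  generalize b 3 = t at *
  set c₀ := (p + q + s + t) / 2 - p with hc0
  set c₁ := (p + q + s + t) / 2 - q with hc1
  set c₂ := (p + q + s + t) / 2 - s with hc2
  set c₃ := (p + q + s + t) / 2 - t with hc3
  set N := (Real.cos (Real.arctan c₀) * Real.cos (Real.arctan c₁)) *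
    (Real.cos (Real.arctan c₂) * Real.cos (Real.arctan c₃)) with hN
  have hNpos : 0 < N := by
    have := Real.cos_arctan_pos
    exact mul_pos (mul_pos (this _) (this _)) (mul_pos (this _) (this _))
  set σ := p * q * s + p * q * t + p * s * t + q * s * t with hσ
  set τ := σ * (p + q + s + t) / 2 - p * q * s * t with hτ
  have hσpos : 0 < σ := by positivity
  -- Maclaurin's inequality `16 * σ₄ ≤ S * σ₃`, written for `τ = σ₃ * S / 2 - σ₄`.
  have hτ7 : 7 * σ * (p + q + s + t) ≤ 16 * τ := by
    have e : 16 * τ - 7 * σ * (p + q + s + t) =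
      p * q * (s - t) ^ 2 + p * s * (q - t) ^ 2 + p * t * (q - s) ^ 2 + q * s * (p - t) ^ 2 +
        q * t * (p - s) ^ 2 + s * t * (p - q) ^ 2 := by
      rw [hτ, hσ]
      ring
    have : 0 ≤ 16 * τ - 7 * σ * (p + q + s + t) := by
      rw [e]
      positivity
    linarith
  have hτpos : 0 < τ := by
    have : 0 < 7 * σ * (p + q + s + t) := by positivity
    linarith
  have hS : 8 ≤ (p + q + s + t) ^ 2 := by
    linarith [sq_nonneg (p - q), sq_nonneg (p - s), sq_nonneg (p - t), sq_nonneg (q - s),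
      sq_nonneg (q - t), sq_nonneg (s - t)]
  have hστ : 49 * σ ^ 2 ≤ 32 * τ ^ 2 := by
    have h4 : (7 * σ * (p + q + s + t)) ^ 2 ≤ (16 * τ) ^ 2 :=
      pow_le_pow_left₀ (by positivity) hτ7 2
    have h5 : σ ^ 2 * 8 ≤ σ ^ 2 * (p + q + s + t) ^ 2 := by gcongr
    linarith
  have hA : 0 < Real.arctan c₀ + Real.arctan c₁ := arctan_add_pos (by rw [hc0, hc1]; linarith)
  have hB : 0 < Real.arctan c₂ + Real.arctan c₃ := arctan_add_pos (by rw [hc2, hc3]; linarith)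
  have hA' := arctan_add_lt_pi c₀ c₁
  have hB' := arctan_add_lt_pi c₂ c₃
  set Θ := Real.arctan c₀ + Real.arctan c₁ + Real.arctan c₂ + Real.arctan c₃ with hΘ
  have hΘ' : Θ = (Real.arctan c₀ + Real.arctan c₁) + (Real.arctan c₂ + Real.arctan c₃) := by
    rw [hΘ]
    ring
  -- Real and imaginary part of `∏ k, (1 + c k * I)`, simplified by the Descartes equation.
  have hcos : Real.cos Θ = -τ * N := by
    rw [hΘ', Real.cos_add, cos_arctan_add, cos_arctan_add, sin_arctan_add, sin_arctan_add]
    have : (1 - c₀ * c₁) * (1 - c₂ * c₃) - (c₀ + c₁) * (c₂ + c₃) = -τ := by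
      rw [hc0, hc1, hc2, hc3, hτ, hσ]
      linear_combination ((p + q + s + t) ^ 2 / 16 - 1 / 4) * hK
    rw [← this, hN]
    ring
  have hsin : Real.sin Θ = σ * N := by
    rw [hΘ', Real.sin_add, cos_arctan_add, cos_arctan_add, sin_arctan_add, sin_arctan_add]
    have : (c₀ + c₁) * (1 - c₂ * c₃) + (1 - c₀ * c₁) * (c₂ + c₃) = σ := by
      rw [hc0, hc1, hc2, hc3, hσ]
      linear_combination (-(p + q + s + t) / 4) * hK
    rw [← this, hN]
    ring
  have hlt : Θ < Real.pi := by
    by_contra! h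
    have h6 : 0 ≤ Real.sin (Θ - Real.pi) :=
      Real.sin_nonneg_of_nonneg_of_le_pi (by linarith) (by linarith)
    rw [Real.sin_sub_pi, hsin] at h6
    linarith [mul_pos hσpos hNpos]
  refine ⟨?_, hlt⟩
  -- The bound is `cos (2 * arccos (1 / 3))`.
  have h7 : Real.cos Θ ≤ -(7 / 9) := by
    have h8 := Real.sin_sq_add_cos_sq Θ
    have h9 : 49 * Real.sin Θ ^ 2 ≤ 32 * Real.cos Θ ^ 2 := by
      rw [hsin, hcos]
      have := mul_le_mul_of_nonneg_right hστ (sq_nonneg N)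
      linarith
    have h10 : Real.cos Θ < 0 := by
      rw [hcos]
      linarith [mul_pos hτpos hNpos]
    by_contra! h
    linarith [mul_pos (show 0 < Real.cos Θ + 7 / 9 by linarith)
      (show 0 < 7 / 9 - Real.cos Θ by linarith)]
  by_contra! h
  have h11 : Real.cos (2 * Real.arccos (1 / 3)) < Real.cos Θ := by
    apply Real.cos_lt_cos_of_nonneg_of_le_pi (by linarith) _ h
    have : Real.arccos (1 / 3) ≤ Real.pi / 2 := Real.arccos_le_pi_div_two.2 (by norm_num)
    linarith
  rw [Real.cos_two_mul, Real.cos_arccos (by norm_num) (by norm_num)] at h11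
  norm_num at h11
  linarith

/-! ### Mid-spheres and tangent lengths -/

theorem IsFourBall.exists_hasTangentLengths {T : Tetrahedron} (hT : T.IsFourBall) :
    ∃ r : Fin 4 → ℝ, (∀ i, 0 < r i) ∧ T.HasTangentLengths r := by
  obtain ⟨S, -, hS⟩ := hT
  have hr : T.HasTangentLengths fun i => √(dist (T.points i) S.center ^ 2 - S.radius ^ 2) := by
    intro i j hij
    obtain ⟨p, hp, ht⟩ := hS i j hij
    have hi := ht.dist_sq_eq_of_mem (left_mem_affineSpan_pair ℝ (T.points i) (T.points j))
    have hj := ht.dist_sq_eq_of_mem (right_mem_affineSpan_pair ℝ (T.points i) (T.points j))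
    simp only [hi, hj, add_sub_cancel_left, Real.sqrt_sq dist_nonneg]
    rw [dist_comm (T.points j) p, dist_add_dist_of_mem_segment hp]
  refine ⟨_, fun i => lt_of_le_of_ne (Real.sqrt_nonneg _) fun h0 => ?_, hr⟩
  obtain ⟨j, k, l, hij, hik, hil, hjk, hjl, hkl⟩ := exists_other_vertices i
  have := hr.face_pos hij hik hil hjk hjl hkl
  simp [← h0] at this

/-- If the edge lengths are `r i + r j`, and every vertex has power `r i ^ 2` with respect to a sphere,
then that sphere is tangent to each edge, at distance `r i` from the vertex `i`. -/
theorem isFourBall_of_power {T : Tetrahedron} {r : Fin 4 → ℝ} (hpos : ∀ i, 0 < r i)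
    (hr : T.HasTangentLengths r) {O : E3} {R : ℝ} (hR : 0 < R)
    (hO : ∀ i, dist (T.points i) O ^ 2 = R ^ 2 + r i ^ 2) : T.IsFourBall := by
  refine ⟨⟨O, R⟩, hR, fun i j hij => ?_⟩
  have hi := hpos i
  have hj := hpos j
  have hne : r i + r j ≠ 0 := by positivity
  set u := T.points j - T.points i with hu
  have huu : ⟪u, u⟫ = (r i + r j) ^ 2 := hr.inner_self hij
  have hwu : ⟪T.points i - O, u⟫ = -(r i * (r i + r j)) := by
    have h1 := hO i
    have h2 := hO j
    rw [dist_eq_norm, ← real_inner_self_eq_norm_sq] at h1 h2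
    have e : T.points j - O = (T.points i - O) + u := by
      rw [hu]
      abel
    rw [e, real_inner_add_add_self, huu] at h2
    linarith
  have hww : ⟪T.points i - O, T.points i - O⟫ = R ^ 2 + r i ^ 2 := by
    rw [← hO i, dist_eq_norm, real_inner_self_eq_norm_sq]
  have hline : AffineMap.lineMap (T.points i) (T.points j) (r i / (r i + r j)) =
      T.points i + (r i / (r i + r j)) • u := by
    rw [AffineMap.lineMap_apply, hu, vsub_eq_sub, vadd_eq_add, add_comm]
  set p := T.points i + (r i / (r i + r j)) • u with hp
  have hpO : p - O = (T.points i - O) + (r i / (r i + r j)) • u := by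
    rw [hp]
    abel
  have hpu : ⟪u, p - O⟫ = 0 := by
    rw [hpO, inner_add_right, real_inner_smul_right, real_inner_comm, hwu, huu]
    field_simp
    ring
  refine ⟨p, ?_, ?_, ?_, ?_⟩
  · rw [segment_eq_image_lineMap, ← hline]
    refine ⟨_, ⟨by positivity, ?_⟩, rfl⟩
    rw [div_le_one (by positivity)]
    linarith
  · rw [EuclideanGeometry.mem_sphere, ← sq_eq_sq₀ dist_nonneg hR.le, dist_eq_norm,
      ← real_inner_self_eq_norm_sq]
    change ⟪p - O, p - O⟫ = R ^ 2
    rw [hpO, real_inner_add_add_self, hww, real_inner_smul_right, hwu, real_inner_smul_left,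
      real_inner_smul_right, huu]
    field_simp
    ring
  · rw [← hline]
    exact AffineMap.lineMap_mem_affineSpan_pair _ _ _
  · apply affineSpan_pair_le_of_mem_of_mem <;>
      rw [EuclideanGeometry.Sphere.mem_orthRadius_iff_inner_left, vsub_eq_sub, vsub_eq_sub]
    · have e : T.points i - p = (-(r i / (r i + r j))) • u := by
        rw [hp]
        module
      rw [e, real_inner_smul_left, hpu, mul_zero]
    · have e : T.points j - p = (1 - r i / (r i + r j)) • u := by
        rw [hp, hu]
        module
      rw [e, real_inner_smul_left, hpu, mul_zero]

/-! ### Regular tetrahedra -/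

theorem exists_hasTangentLengths_of_equilateral {T : Tetrahedron} (hT : T.Equilateral) :
    ∃ a : ℝ, 0 < a ∧ T.HasTangentLengths fun _ => a := by
  obtain ⟨e, he⟩ := hT
  refine ⟨e / 2, ?_, fun i j hij => by rw [he i j hij]; ring⟩
  rw [← he 0 1 (by decide)]
  exact half_pos (dist_pos.2 (T.independent.injective.ne (by decide)))

theorem isFourBall_of_equilateral {T : Tetrahedron} (hT : T.Equilateral) : T.IsFourBall := by
  obtain ⟨a, ha, hr⟩ := exists_hasTangentLengths_of_equilateral hT
  -- The mid-sphere of a regular tetrahedron is centred at the centroid.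
  refine isFourBall_of_power (O := (1 / 4 : ℝ) • ∑ i, T.points i) (R := a / √2) (fun _ => ha) hr
    (by positivity) fun i => ?_
  obtain ⟨j, k, l, hij, hik, hil, hjk, hjl, hkl⟩ := exists_other_vertices i
  have e : T.points i - (1 / 4 : ℝ) • ∑ i, T.points i = (-(1 / 4) : ℝ) •
      ((T.points j - T.points i) + (T.points k - T.points i) + (T.points l - T.points i)) := by
    rw [sum_eq_of_distinct T.points hij hik hil hjk hjl hkl]
    module
  rw [dist_eq_norm, ← real_inner_self_eq_norm_sq, e, real_inner_smul_left, real_inner_smul_right,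
    real_inner_add_add_self, real_inner_add_add_self, inner_add_left, hr.inner_self hij,
    hr.inner_self hik, hr.inner_self hil, hr.inner_edges hij hik hjk, hr.inner_edges hij hil hjl,
    hr.inner_edges hik hil hkl, div_pow, Real.sq_sqrt (by norm_num)]
  ring

theorem two_mul_arctan_inv_sqrt_two : 2 * Real.arctan (1 / √2) = Real.arccos (1 / 3) := by
  have h0 : 0 ≤ Real.arctan (1 / √2) := Real.arctan_nonneg.2 (by positivity)
  have h1 := Real.arctan_lt_pi_div_two (1 / √2)
  rw [← Real.arccos_cos (x := 2 * Real.arctan (1 / √2)) (by linarith) (by linarith),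
    Real.cos_two_mul, Real.cos_sq_arctan, div_pow, Real.sq_sqrt (by norm_num)]
  norm_num

theorem dihedralAngleSum_of_equilateral {T : Tetrahedron} (hT : T.Equilateral) :
    T.dihedralAngleSum = 6 * Real.arccos (1 / 3) := by
  obtain ⟨a, ha, hr⟩ := exists_hasTangentLengths_of_equilateral hT
  have h2 : 0 < √(2 : ℝ) := by positivity
  rw [HasTangentLengths.dihedralAngleSum_eq (b := fun _ => 1 / √2) (ρ := a / √2) (by positivity)
    (fun _ => by positivity) (by convert hr using 2; field_simp)]
  · have e : 4 * (1 / √2) / 2 - 1 / √2 = 1 / √2 := by ring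
    simp only [Finset.sum_const, Finset.card_univ, Fintype.card_fin, nsmul_eq_mul, Nat.cast_ofNat,
      e, ← two_mul_arctan_inv_sqrt_two]
    ring
  · simp only [Finset.sum_const, Finset.card_univ, Fintype.card_fin, nsmul_eq_mul, Nat.cast_ofNat,
      mul_pow, div_pow, Real.sq_sqrt (show (0 : ℝ) ≤ 2 by norm_num)]
    norm_num

/-! ### Regular pyramids -/

/-- The tangent lengths of the regular pyramid of height `h`: half a base edge at the base vertices,
the rest of a lateral edge at the apex. -/
noncomputable def pyramidRadii (h : ℝ) : Fin 4 → ℝ :=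
  ![√3 / 2, √3 / 2, √3 / 2, √(1 + h ^ 2) - √3 / 2]

theorem sqrt_three_lt_two : √(3 : ℝ) < 2 := by
  rw [Real.sqrt_lt' (by norm_num)]
  norm_num

theorem pyramidRadii_pos (h : ℝ) (i : Fin 4) : 0 < pyramidRadii h i := by
  have h3 : 0 < √(3 : ℝ) := by positivity
  have h1 : 1 ≤ √(1 + h ^ 2) := Real.one_le_sqrt.2 (by nlinarith)
  have := sqrt_three_lt_two
  fin_cases i <;> simp [pyramidRadii]
  linarith

theorem hasTangentLengths_regularPyramid {h : ℝ} (hh : 0 < h) :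
    (regularPyramid h hh).HasTangentLengths (pyramidRadii h) := by
  intro i j hij
  have h3 : √(3 : ℝ) ^ 2 = 3 := Real.sq_sqrt (by norm_num)
  have hL : √(1 + h ^ 2) ^ 2 = 1 + h ^ 2 := Real.sq_sqrt (by positivity)
  rw [← sq_eq_sq₀ dist_nonneg (add_pos (pyramidRadii_pos h i) (pyramidRadii_pos h j)).le,
    EuclideanSpace.dist_eq, Real.sq_sqrt (by positivity)]
  fin_cases i <;> fin_cases j <;>
    simp [regularPyramid, pyramidPoints, pyramidRadii, Fin.sum_univ_three, Real.dist_eq] at hij ⊢ <;>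
    linarith

theorem isFourBall_regularPyramid {h : ℝ} (hh : 0 < h) : (regularPyramid h hh).IsFourBall := by
  have h3 : √(3 : ℝ) ^ 2 = 3 := Real.sq_sqrt (by norm_num)
  set s := √(1 + h ^ 2) - √3 / 2 with hs
  -- The height on the axis at which the apex has power `s ^ 2` and the base vertices have power
  -- `3 / 4` with respect to one sphere.
  set z := (h ^ 2 - 1 / 4 - s ^ 2) / (2 * h) with hz
  have hz' : 2 * h * z = h ^ 2 - 1 / 4 - s ^ 2 := by
    rw [hz]
    field_simp
  refine isFourBall_of_power (O := !₂[0, 0, z]) (R := √(z ^ 2 + 1 / 4)) (pyramidRadii_pos h)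
    (hasTangentLengths_regularPyramid hh) (by positivity) fun i => ?_
  rw [EuclideanSpace.dist_eq, Real.sq_sqrt (by positivity), Real.sq_sqrt (by positivity)]
  fin_cases i <;>
    simp [regularPyramid, pyramidPoints, pyramidRadii, Fin.sum_univ_three, Real.dist_eq, ← hs] <;>
    linarith

theorem equilateral_regularPyramid {h : ℝ} (hh : 0 < h) (h2 : h ^ 2 = 2) :
    (regularPyramid h hh).Equilateral := by
  refine ⟨√3, fun i j hij => ?_⟩
  rw [hasTangentLengths_regularPyramid hh i j hij]
  fin_cases i <;> fin_cases j <;> simp [pyramidRadii, h2] at hij ⊢ <;> norm_num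

/-- The dihedral angle sum as a function of the tangent lengths, where the Descartes form is positive. -/
noncomputable def curvatureAngleSum (r : Fin 4 → ℝ) : ℝ :=
  3 * ∑ k, Real.arctan ((∑ i, curvature r i) / 2 - curvature r k)

theorem continuousAt_curvatureAngleSum {r : Fin 4 → ℝ} (hr : ∀ i, 0 < r i)
    (hD : 0 < (∑ i, (r i)⁻¹) ^ 2 - 2 * ∑ i, (r i)⁻¹ ^ 2) :
    ContinuousAt curvatureAngleSum r := by
  have hinv (i : Fin 4) : ContinuousAt (fun r : Fin 4 → ℝ => (r i)⁻¹) r :=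
    (continuous_apply i).continuousAt.inv₀ (hr i).ne'
  have hc (i : Fin 4) : ContinuousAt (fun r => curvature r i) r := by
    have hDc : ContinuousAt
        (fun r : Fin 4 → ℝ => (∑ i, (r i)⁻¹) ^ 2 - 2 * ∑ i, (r i)⁻¹ ^ 2) r := by
      fun_prop
    have hne := (Real.sqrt_pos.2 hD).ne'
    exact (continuousAt_const.div hDc.sqrt hne).mul (hinv i)
  unfold curvatureAngleSum
  have := Real.continuous_arctan
  fun_prop

theorem continuous_pyramidRadii : Continuous pyramidRadii := by
  refine continuous_pi fun i => ?_
  fin_cases i <;> simp [pyramidRadii] <;> fun_prop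

/-- At height `0` the Descartes form vanishes, so for small heights the arctangents that belong to the
base vertices are close to `π / 2`, while the fourth one is at least `-π / 2`. -/
theorem exists_lt_curvatureAngleSum {v : ℝ} (hv : v < 3 * Real.pi) {ε : ℝ} (hε : 0 < ε) :
    ∃ h, 0 < h ∧ h < ε ∧ v < curvatureAngleSum (pyramidRadii h) := by
  set D : ℝ → ℝ := fun h =>
    (∑ i, (pyramidRadii h i)⁻¹) ^ 2 - 2 * ∑ i, (pyramidRadii h i)⁻¹ ^ 2 with hD
  have h3 : √(3 : ℝ) ^ 2 = 3 := Real.sq_sqrt (by norm_num)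
  have h3pos : 0 < √(3 : ℝ) := by positivity
  have hcont : Continuous D := by
    have (i : Fin 4) : Continuous fun h => (pyramidRadii h i)⁻¹ :=
      ((continuous_apply i).comp continuous_pyramidRadii).inv₀ fun h => (pyramidRadii_pos h i).ne'
    fun_prop
  have hD0 : D 0 = 0 := by
    have e1 : (√3 / 2)⁻¹ = 2 * √3 / 3 := by
      field_simp
      linarith
    -- The apex tangent length at height `0` is `1 - √3 / 2`.
    have e2 : (1 - √3 / 2)⁻¹ = 4 + 2 * √3 := inv_eq_of_mul_eq_one_left (by linarith)
    have e (i : Fin 4) : (pyramidRadii 0 i)⁻¹ =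
        ![2 * √3 / 3, 2 * √3 / 3, 2 * √3 / 3, 4 + 2 * √3] i := by
      fin_cases i <;> simp [pyramidRadii, e1, e2, -inv_div]
    simp only [hD, e, Fin.sum_univ_four, Matrix.cons_val]
    linarith
  have hDpos {h : ℝ} (hh : 0 < h) : 0 < D h :=
    (hasTangentLengths_regularPyramid hh).descartes_pos (pyramidRadii_pos h)
  have hlim : Filter.Tendsto (fun h => √(D h)) (nhdsWithin 0 (Set.Ioi 0))
      (nhdsWithin 0 (Set.Ioi 0)) := by
    refine tendsto_nhdsWithin_iff.2 ⟨?_, ?_⟩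
    · have := (Real.continuous_sqrt.comp hcont).tendsto 0
      simp only [Function.comp, hD0, Real.sqrt_zero] at this
      exact this.mono_left nhdsWithin_le_nhds
    · filter_upwards [self_mem_nhdsWithin] with h hh
      exact Real.sqrt_pos.2 (hDpos hh)
  have hatan := (Real.tendsto_arctan_atTop.mono_right nhdsWithin_le_nhds).comp
    (tendsto_inv_nhdsGT_zero.comp hlim)
  have hev := hatan.eventually (lt_mem_nhds (show Real.pi / 2 - (3 * Real.pi - v) / 9 <
    Real.pi / 2 by linarith))
  obtain ⟨h, hh1, hh2, hh3⟩ := (hev.and ((Ioo_mem_nhdsGT hε))).exists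
  refine ⟨h, hh2, hh3, ?_⟩
  have hlow (k : Fin 4) (hk : pyramidRadii h k = √3 / 2) :
    Real.pi / 2 - (3 * Real.pi - v) / 9 <
      Real.arctan ((∑ i, curvature (pyramidRadii h) i) / 2 - curvature (pyramidRadii h) k) := by
    refine hh1.trans_le (Real.arctan_mono ?_)
    have hs := pyramidRadii_pos h 3
    have hq := Real.sqrt_pos.2 (hDpos hh2)
    simp only [Function.comp, curvature, hk]
    rw [← Finset.mul_sum]
    change _ ≤ 2 / √(D h) * _ / 2 - 2 / √(D h) * _
    have e : ∑ i, (pyramidRadii h i)⁻¹ = 3 * (√3 / 2)⁻¹ + (pyramidRadii h 3)⁻¹ := by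
      simp only [Fin.sum_univ_four, pyramidRadii]
      simp
      ring
    rw [e]
    have h1 : 1 ≤ (√3 / 2)⁻¹ := (one_le_inv₀ (by positivity)).2 (by linarith [sqrt_three_lt_two])
    have h2 : 0 < (pyramidRadii h 3)⁻¹ := inv_pos.2 hs
    have e2 : 2 / √(D h) * (3 * (√3 / 2)⁻¹ + (pyramidRadii h 3)⁻¹) / 2 - 2 / √(D h) * (√3 / 2)⁻¹ =
      (√(D h))⁻¹ * ((√3 / 2)⁻¹ + (pyramidRadii h 3)⁻¹) := by
      ring
    rw [e2]
    exact le_mul_of_one_le_right (inv_pos.2 hq).le (by linarith)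
  have l0 := hlow 0 rfl
  have l1 := hlow 1 rfl
  have l2 := hlow 2 rfl
  have l3 := Real.neg_pi_div_two_lt_arctan
    ((∑ i, curvature (pyramidRadii h) i) / 2 - curvature (pyramidRadii h) 3)
  rw [curvatureAngleSum, Fin.sum_univ_four
    (f := fun k => Real.arctan ((∑ i, curvature (pyramidRadii h) i) / 2 - curvature _ k))]
  linarith

theorem exists_regularPyramid {v : ℝ} (hv : 6 * Real.arccos (1 / 3) ≤ v)
    (hv' : v < 3 * Real.pi) :
    ∃ (h : ℝ) (hh : 0 < h), (regularPyramid h hh).dihedralAngleSum = v := by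
  have h2 : 0 < √(2 : ℝ) := by positivity
  obtain ⟨h, hh, hlt, hvh⟩ := exists_lt_curvatureAngleSum hv' h2
  have heq {x : ℝ} (hx : 0 < x) :
      (regularPyramid x hx).dihedralAngleSum = curvatureAngleSum (pyramidRadii x) :=
    (hasTangentLengths_regularPyramid hx).dihedralAngleSum_eq_curvature (pyramidRadii_pos x)
  have hcont : ContinuousOn (fun x => curvatureAngleSum (pyramidRadii x)) (Set.Icc h √2) := by
    intro x hx
    have hx0 : 0 < x := hh.trans_le hx.1
    exact ((continuousAt_curvatureAngleSum (pyramidRadii_pos x)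
      ((hasTangentLengths_regularPyramid hx0).descartes_pos (pyramidRadii_pos x))).comp
      continuous_pyramidRadii.continuousAt).continuousWithinAt
  have hend : curvatureAngleSum (pyramidRadii √2) = 6 * Real.arccos (1 / 3) := by
    rw [← heq h2]
    exact dihedralAngleSum_of_equilateral
      (equilateral_regularPyramid h2 (Real.sq_sqrt (by norm_num)))
  obtain ⟨x, hx, hxv⟩ := intermediate_value_Icc' hlt.le hcont ⟨hend.trans_le hv, hvh.le⟩
  exact ⟨x, hh.trans_le hx.1, (heq _).trans hxv⟩

end Tetrahedron

theorem theorem9 :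
    (∀ T : Tetrahedron, T.IsFourBall →
      6 * Real.arccos (1 / 3) ≤ T.dihedralAngleSum ∧ T.dihedralAngleSum < 3 * Real.pi) ∧
    (∀ v : ℝ, 6 * Real.arccos (1 / 3) ≤ v → v < 3 * Real.pi →
      ∃ T : Tetrahedron, T.IsFourBall ∧ T.dihedralAngleSum = v) ∧
    (∀ T : Tetrahedron, T.Equilateral →
      T.IsFourBall ∧ T.dihedralAngleSum = 6 * Real.arccos (1 / 3)) ∧
    (∀ (h : ℝ) (hh : 0 < h), (Tetrahedron.regularPyramid h hh).IsFourBall) ∧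
    (∀ v : ℝ, 6 * Real.arccos (1 / 3) ≤ v → v < 3 * Real.pi →
      ∃ (h : ℝ) (hh : 0 < h), (Tetrahedron.regularPyramid h hh).dihedralAngleSum = v) := by
  refine ⟨fun T hT => ?_, fun v hv hv' => ?_, fun T hT => ⟨Tetrahedron.isFourBall_of_equilateral hT,
    Tetrahedron.dihedralAngleSum_of_equilateral hT⟩,
    fun h hh => Tetrahedron.isFourBall_regularPyramid hh,
    fun v hv hv' => Tetrahedron.exists_regularPyramid hv hv'⟩
  · obtain ⟨r, hpos, hr⟩ := hT.exists_hasTangentLengths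
    have := Tetrahedron.sum_arctan_bounds (hr.curvature_pos hpos) (hr.descartes hpos)
    rw [hr.dihedralAngleSum_eq_curvature hpos]
    constructor <;> linarith
  · obtain ⟨h, hh, e⟩ := Tetrahedron.exists_regularPyramid hv hv'
    exact ⟨_, Tetrahedron.isFourBall_regularPyramid hh, e⟩
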